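/- Let $\mathbb G$ be a homogeneous group: a connected, simply connected Lie group whose Lie algebra $\mathfrak g$ carries dilations $D_\lambda=\mathrm{Exp}(A\ln\lambda)$, $\lambda>0$, where $A$ is a diagonalisable linear operator on $\mathfrak g$ with positive eigenvalues and every $D_\lambda$ is a Lie algebra morphism. Write $D_\lambda$ also for the induced dilations of $\mathbb G$ (the automorphisms of $\mathbb G$ with differential $D_\lambda$ at the identity, $\exp X\mapsto\exp(D_\lambda X)$), $Q=\mathrm{Tr}\,A$ for the homogeneous dimension, $dx$ and $|S|$ for a Haar measure, and $0$ for the identity of $\mathbb G$. Let $|\cdot|$ be a homogeneous quasi-norm on $\mathbb G$, that is, a continuous function $\mathbb G\to[0,\infty)$ with $|x^{-1}|=|x|$, $|D_\lambda x|=\lambda|x|$ for $\lambda>0$, and $|x|=0$ if and only if $x=0$. Put $B(x,r)=\{y\in\mathbb G:|x^{-1}y|<r\}$. Let $1<p<\infty$. There is a constant $C_p>0$ (depending on $p$, and on the fixed group, dilations, quasi-norm and Haar measure, but on nothing else) such that the following holds. Let $\phi:(0,\infty)\to(0,\infty)$ be nonincreasing with $t\mapsto t^{Q/p}\phi(t)$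 nondecreasing, and let $L^{p,\phi}(\mathbb G)$ be the generalised Morrey space of all $f\in L^p_{loc}(\mathbb G)$ with $$\|f\|_{L^{p,\phi}(\mathbb G)}:=\sup_{r>0}\frac1{\phi(r)}\left(\frac1{r^Q}\int_{B(0,r)}|f(x)|^p\,dx\right)^{1/p}<\infty .$$ Then for every $f\in L^{p,\phi}(\mathbb G)$ the Hardy–Littlewood maximal function $$Mf(x):=\sup_{B\ni x}\frac1{|B|}\int_B|f(y)|\,dy ,$$ where the supremum is over all quasi-balls $B=B(z,r)$, $z\in\mathbb G$, $r>0$, that contain $x$, belongs to $L^{p,\phi}(\mathbb G)$, and $$\|Mf\|_{L^{p,\phi}(\mathbb G)}\le C_p\,\|f\|_{L^{p,\phi}(\mathbb G)} .$$ -/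

import Mathlib

open MeasureTheory Set
open scoped Manifold ContDiff ENNReal NNReal

noncomputable section

/-- The dilation `D_r = Exp (A ln r)` of the Lie algebra `T_1 G` generated by a linear operator `A`
on it. The exponential is that of the normed algebra of operators on the vector space `E` that
underlies `T_1 G`. -/
def lieAlgebraDilation {E : Type*} [NormedAddCommGroup E] [NormedSpace ℝ E]
    {G : Type*} [TopologicalSpace G] [ChartedSpace E G] [Group G]
    (A : GroupLieAlgebra 𝓘(ℝ, E) G →L[ℝ] GroupLieAlgebra 𝓘(ℝ, E) G) (r : ℝ) :
    GroupLieAlgebra 𝓘(ℝ, E) G →L[ℝ] GroupLieAlgebra 𝓘(ℝ, E) G :=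
  let B : E →L[ℝ] E := A
  (NormedSpace.exp (Real.log r • B) : E →L[ℝ] E)

/-- The dilation structure that makes a (connected, simply connected) Lie group `G` a homogeneous
group: a diagonalisable operator `A` with positive eigenvalues on the Lie algebra `T_1 G` whose
dilations `D_r = Exp (A ln r)`, `r > 0`, are Lie algebra morphisms, together with the dilations
`δ r` of the group that they induce.

The dilation of `G` by `r > 0` is the automorphism of the Lie group `G` with differential `D_r` at
the identity. It is unique as `G` is connected, it exists as `G` is simply connected, and by
naturality of the exponential map it is the map `exp X ↦ exp (D_r X)`.
The values of `δ` at `r ≤ 0` are irrelevant. -/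
structure HomogeneousStructure (E : Type*) [NormedAddCommGroup E] [NormedSpace ℝ E]
    [FiniteDimensional ℝ E] (G : Type*) [TopologicalSpace G] [ChartedSpace E G] [Group G] where
  /-- The generator of the dilations of the Lie algebra. -/
  A : GroupLieAlgebra 𝓘(ℝ, E) G →L[ℝ] GroupLieAlgebra 𝓘(ℝ, E) G
  /-- `A` is diagonalisable and positive: there is a basis of eigenvectors of `A`, with positive
  eigenvalues. -/
  exists_eigenbasis : ∃ (b : Module.Basis (Fin (Module.finrank ℝ E)) ℝ (GroupLieAlgebra 𝓘(ℝ, E) G))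
    (ν : Fin (Module.finrank ℝ E) → ℝ), ∀ i, 0 < ν i ∧ A (b i) = ν i • b i
  /-- Each `D_r` is a morphism of the Lie algebra. -/
  lie_dilation : ∀ r : ℝ, 0 < r → ∀ X Y : GroupLieAlgebra 𝓘(ℝ, E) G,
    ⁅lieAlgebraDilation A r X, lieAlgebraDilation A r Y⁆ = lieAlgebraDilation A r ⁅X, Y⁆
  /-- The dilations of the group. -/
  δ : ℝ → G ≃* G
  /-- The dilations of the group are smooth. -/
  contMDiff_δ : ∀ r : ℝ, 0 < r → ContMDiff 𝓘(ℝ, E) 𝓘(ℝ, E) ∞ (δ r)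
  /-- The differential of `δ r` at the identity is `D_r`. -/
  mfderiv_δ : ∀ r : ℝ, 0 < r → ∀ X : GroupLieAlgebra 𝓘(ℝ, E) G,
    (mfderiv 𝓘(ℝ, E) 𝓘(ℝ, E) (δ r) 1 X : E) = lieAlgebraDilation A r X

namespace HomogeneousStructure

variable {E : Type*} [NormedAddCommGroup E] [NormedSpace ℝ E] [FiniteDimensional ℝ E]
  {G : Type*} [TopologicalSpace G] [ChartedSpace E G] [Group G]

/-- The homogeneous dimension `Q = Tr A`. -/
def homDim (H : HomogeneousStructure E G) : ℝ :=
  LinearMap.trace ℝ (GroupLieAlgebra 𝓘(ℝ, E) G) H.A.toLinearMap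

/-- A homogeneous quasi-norm: a continuous, nonnegative, symmetric and definite function on `G`
that is homogeneous of degree one with respect to the dilations. -/
structure QuasiNorm (H : HomogeneousStructure E G) where
  /-- The function `x ↦ |x|`. -/
  toFun : G → ℝ
  continuous_toFun : Continuous toFun
  nonneg : ∀ x, 0 ≤ toFun x
  symmetric : ∀ x, toFun x⁻¹ = toFun x
  homogeneous : ∀ r : ℝ, 0 < r → ∀ x, toFun (H.δ r x) = r * toFun x
  definite : ∀ x, toFun x = 0 ↔ x = 1

namespace QuasiNorm

variable {H : HomogeneousStructure E G}

/-- The quasi-ball `B(x, R) = {y | |x⁻¹ y| < R}`. -/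
def ball (N : H.QuasiNorm) (x : G) (R : ℝ) : Set G := {y | N.toFun (x⁻¹ * y) < R}

variable [MeasurableSpace G] {F : Type*}

/-- The Hardy-Littlewood maximal function: `M f x` is the supremum, over all quasi-balls `B` that
contain `x`, of the average of `|f|` over `B`. -/
def maximal (N : H.QuasiNorm) (μ : Measure G) [ENorm F] (f : G → F) (x : G) : ℝ≥0∞ :=
  ⨆ (z : G) (r : ℝ) (_ : 0 < r) (_ : x ∈ N.ball z r),
    (μ (N.ball z r))⁻¹ * ∫⁻ y in N.ball z r, ‖f y‖ₑ ∂μ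

/-- The generalised Morrey norm
`sup_{r > 0} φ(r)⁻¹ (r^{-Q} ∫_{B(1, r)} |f|^p)^{1/p}`, where `1` is the identity of `G`. -/
def morreyNorm (N : H.QuasiNorm) (μ : Measure G) (p : ℝ) (φ : ℝ → ℝ) [ENorm F] (f : G → F) :
    ℝ≥0∞ :=
  ⨆ (r : ℝ) (_ : 0 < r), (ENNReal.ofReal (φ r))⁻¹ *
    ((ENNReal.ofReal (r ^ H.homDim))⁻¹ * ∫⁻ x in N.ball 1 r, ‖f x‖ₑ ^ p ∂μ) ^ (1 / p)

/-- The generalised Morrey space `L^{p,φ}(G)`: the functions in `L^p_loc(G)` whose generalised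
Morrey norm is finite. -/
def MemMorrey (N : H.QuasiNorm) (μ : Measure G) (p : ℝ) (φ : ℝ → ℝ) [TopologicalSpace F]
    [ContinuousENorm F] (f : G → F) : Prop :=
  (∀ K : Set G, IsCompact K → MemLp f (ENNReal.ofReal p) (μ.restrict K)) ∧
    N.morreyNorm μ p φ f < ⊤

end QuasiNorm

end HomogeneousStructure

end

noncomputable section

open Filter Topology Pointwise

/-! ### Topology of quasi-balls and the quasi-triangle inequality. -/

namespace HomogeneousStructure

variable {E : Type*} [NormedAddCommGroup E] [NormedSpace ℝ E] [FiniteDimensional ℝ E]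
  {G : Type*} [TopologicalSpace G] [ChartedSpace E G] [Group G]

/-! Let `L = 2 * K ^ 2`, with `K` the quasi-triangle constant, and let `B(z, t)` be an averaging
ball through a point of `B(1, r)`. By `ball_subset_or` there are two cases. If `B(z, t)` lies in
`B(1, L r)`, the average only sees `f` on `B(1, L r)`, and the strong (p, p) bound applies; that
bound comes from Vitali covering, weak (1, 1) and the layer-cake formula. Otherwise `B(z, t)` lies
in `B(1, s)` with `s = L t ≥ r`. Doubling and Hölder bound the p-th power of the average by a
constant times `s ^ Q / |B(1, s)| * (φ s * ‖f‖) ^ p`. Neither `φ` nor `s ^ Q / |B(1, s)|` increases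
with `s`, so `s` may be replaced by `r`, and integration over `B(1, r)` cancels `|B(1, r)|`.

The remaining work is geometry that the definitions leave implicit. Small quasi-balls must be small
in the topology (`exists_ball_subset_of_isCompact`); the quasi-triangle inequality and the
finiteness of ball measures then follow by dilation. The exponent `Q` must be tied to Haar measure:
`measure_ball_le_rpow_mul` compares Haar measure with volume in a chart, where `δ r` has derivative
of determinant `r ^ Q` at the identity. Only an upper bound for `|B(1, r)|`, `r ≤ 1`, is needed. -/

/-- The dilation by `r > 0` as an automorphism of the topological group. -/
def dilation [IsTopologicalGroup G] [T2Space G] [LocallyCompactSpace G] [SigmaCompactSpace G]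
    (H : HomogeneousStructure E G) (r : ℝ) (hr : 0 < r) : G ≃ₜ* G where
  toMulEquiv := H.δ r
  continuous_toFun := (H.contMDiff_δ r hr).continuous
  continuous_invFun := by
    -- Only `δ r` itself is assumed smooth; the open mapping theorem for σ-compact groups makes its
    -- inverse continuous.
    have ho : IsOpenMap (H.δ r) := MonoidHom.isOpenMap_of_sigmaCompact (H.δ r).toMonoidHom
      (H.δ r).surjective (H.contMDiff_δ r hr).continuous
    exact ((H.δ r).toEquiv.toHomeomorphOfContinuousOpen
      (H.contMDiff_δ r hr).continuous ho).symm.continuous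

@[simp]
theorem coe_dilation [IsTopologicalGroup G] [T2Space G] [LocallyCompactSpace G]
    [SigmaCompactSpace G] (H : HomogeneousStructure E G) (r : ℝ) (hr : 0 < r) :
    ⇑(H.dilation r hr) = H.δ r := rfl

namespace QuasiNorm

variable {H : HomogeneousStructure E G} (N : H.QuasiNorm)

theorem map_one : N.toFun 1 = 0 := (N.definite 1).2 rfl

theorem pos {x : G} (hx : x ≠ 1) : 0 < N.toFun x :=
  (N.nonneg x).lt_of_ne fun h ↦ hx ((N.definite x).1 h.symm)

theorem mem_ball {x y : G} {r : ℝ} : y ∈ N.ball x r ↔ N.toFun (x⁻¹ * y) < r := Iff.rfl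

theorem mem_ball_one {y : G} {r : ℝ} : y ∈ N.ball 1 r ↔ N.toFun y < r := by
  simp [mem_ball]

theorem self_mem_ball (x : G) {r : ℝ} (hr : 0 < r) : x ∈ N.ball x r := by
  simpa [mem_ball, N.map_one] using hr

theorem ball_mono (x : G) {r s : ℝ} (h : r ≤ s) : N.ball x r ⊆ N.ball x s :=
  fun _ hy ↦ lt_of_lt_of_le hy h

theorem ball_eq_preimage (x : G) (r : ℝ) : N.ball x r = (fun y ↦ x⁻¹ * y) ⁻¹' N.ball 1 r := by
  ext y; simp [mem_ball]

theorem preimage_δ_ball_one {r : ℝ} (hr : 0 < r) (s : ℝ) :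
    H.δ r ⁻¹' N.ball 1 (r * s) = N.ball 1 s := by
  ext y; simp [mem_ball_one, N.homogeneous r hr, hr]

theorem image_δ_ball_one {r : ℝ} (hr : 0 < r) (s : ℝ) :
    H.δ r '' N.ball 1 s = N.ball 1 (r * s) := by
  rw [← N.preimage_δ_ball_one hr, image_preimage_eq _ (H.δ r).surjective]

theorem inv_ball_one (r : ℝ) : (N.ball 1 r)⁻¹ = N.ball 1 r := by
  ext y; simp [mem_ball_one, N.symmetric]

theorem isOpen_ball [IsTopologicalGroup G] (x : G) (r : ℝ) : IsOpen (N.ball x r) :=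
  isOpen_lt (N.continuous_toFun.comp (by fun_prop)) continuous_const

theorem exists_pos_le_of_isCompact {S : Set G} (hS : IsCompact S) (h1 : (1 : G) ∉ S) :
    ∃ m > 0, ∀ x ∈ S, m ≤ N.toFun x := by
  rcases S.eq_empty_or_nonempty with rfl | hne
  · exact ⟨1, one_pos, by simp⟩
  · obtain ⟨x, hx, hmin⟩ := hS.exists_isMinOn hne N.continuous_toFun.continuousOn
    exact ⟨N.toFun x, N.pos fun h ↦ h1 (h ▸ hx), fun y hy ↦ hmin hy⟩

/-- The quasi-norm is at least some `m > 0` on the compact frontier of `V`, which misses `1`, so a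
connected set through `1` with quasi-norm below `m` cannot cross it. -/
theorem exists_subset_of_isPreconnected [T2Space G] {V : Set G} (hV : IsCompact V)
    (hV1 : V ∈ 𝓝 (1 : G)) :
    ∃ m > 0, ∀ C : Set G, IsPreconnected C → 1 ∈ C → (∀ x ∈ C, N.toFun x < m) → C ⊆ V := by
  have hfr : IsCompact (frontier V) := hV.of_isClosed_subset isClosed_frontier
    hV.isClosed.frontier_subset
  obtain ⟨m, hm, hmin⟩ := N.exists_pos_le_of_isCompact hfr
    fun h ↦ h.2 (mem_interior_iff_mem_nhds.2 hV1)
  refine ⟨m, hm, fun C hC h1 hCm ↦ ?_⟩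
  refine (hC.subset_left_of_subset_union isOpen_interior hV.isClosed.isOpen_compl
    (disjoint_compl_right.mono_left interior_subset) (fun x hx ↦ ?_)
    ⟨1, h1, mem_interior_iff_mem_nhds.2 hV1⟩).trans interior_subset
  by_contra hcon
  simp only [mem_union, mem_compl_iff, not_or, not_not] at hcon
  exact (hCm x hx).not_ge (hmin x ⟨subset_closure hcon.2, hcon.1⟩)

theorem toFun_iterate {s : ℝ} (hs : 0 < s) (n : ℕ) (x : G) :
    N.toFun ((H.δ s)^[n] x) = s ^ n * N.toFun x := by
  induction n with
  | zero => simp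
  | succ n ih => rw [Function.iterate_succ_apply', N.homogeneous s hs, ih]; ring

/-- Join `1` to `x` by a path. The quasi-norm is bounded on it, so iterating `δ s` makes it
uniformly small on a connected image through `1`. -/
theorem exists_iterate_mem (N : H.QuasiNorm) [T2Space G] [PathConnectedSpace G] {V : Set G} (hV : IsCompact V) (hV1 : V ∈ 𝓝 (1 : G)) {s : ℝ}
    (hs : 0 < s) (hs1 : s < 1) (x : G) : ∃ n, (H.δ s)^[n] x ∈ V := by
  obtain ⟨m, hm, hC⟩ := N.exists_subset_of_isPreconnected hV hV1
  obtain ⟨γ⟩ := PathConnectedSpace.joined (1 : G) x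
  obtain ⟨M, hM⟩ := (isCompact_range γ.continuous).bddAbove_image N.continuous_toFun.continuousOn
  have ht : Tendsto (fun n : ℕ ↦ s ^ n * M) atTop (𝓝 (0 * M)) :=
    (tendsto_pow_atTop_nhds_zero_of_lt_one hs.le hs1).mul_const M
  rw [zero_mul] at ht
  obtain ⟨n, hn⟩ := (ht.eventually_lt_const hm).exists
  have hcont : Continuous (H.δ s)^[n] := (H.contMDiff_δ s hs).continuous.iterate n
  refine ⟨n, hC ((H.δ s)^[n] '' range γ)
    ((isPreconnected_range γ.continuous).image _ hcont.continuousOn) ⟨1, ⟨0, by simp⟩, ?_⟩ ?_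
    ⟨x, ⟨1, by simp⟩, rfl⟩⟩
  · exact iterate_map_one _ n
  · rintro _ ⟨y, hy, rfl⟩
    rw [N.toFun_iterate hs]
    exact (mul_le_mul_of_nonneg_left (hM ⟨y, hy, rfl⟩) (by positivity)).trans_lt hn

section LocallyCompact

variable [IsTopologicalGroup G] [T2Space G] [LocallyCompactSpace G] [SigmaCompactSpace G]
  [PathConnectedSpace G]

/-- Stop the orbit of a point `x ∉ V` under `δ (1 / 2)` just before it first enters `V`. That
iterate lies in a compact set missing `1`, where the quasi-norm is at least `m`; halving has only
decreased it, so `x` is not in `B(1, m)`. -/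
theorem exists_ball_subset_of_isCompact {V : Set G} (hV : IsCompact V) (hV1 : V ∈ 𝓝 (1 : G)) :
    ∃ m > 0, N.ball 1 m ⊆ V := by
  have hs : (0 : ℝ) < 1 / 2 := by norm_num
  have hS : IsCompact (H.δ (1 / 2) ⁻¹' V \ interior V) :=
    ((H.dilation _ hs).toHomeomorph.isCompact_preimage.2 hV).diff isOpen_interior
  obtain ⟨m, hm, hmin⟩ := N.exists_pos_le_of_isCompact hS
    fun h ↦ h.2 (mem_interior_iff_mem_nhds.2 hV1)
  refine ⟨m, hm, fun x hx ↦ ?_⟩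
  rw [mem_ball_one] at hx
  by_contra hxV
  classical
  have hex := N.exists_iterate_mem hV hV1 hs (by norm_num) x
  obtain ⟨k, hk⟩ : ∃ k, Nat.find hex = k + 1 := Nat.exists_eq_succ_of_ne_zero fun h0 ↦ by
    have := Nat.find_spec hex
    rw [h0] at this
    exact hxV this
  have h1 := Nat.find_spec hex
  rw [hk, Function.iterate_succ_apply'] at h1
  have h2 : (H.δ (1 / 2))^[k] x ∉ V := Nat.find_min hex (by omega)
  have h3 := hmin _ ⟨h1, fun h ↦ h2 (interior_subset h)⟩
  rw [N.toFun_iterate hs] at h3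
  have h4 : ((1 : ℝ) / 2) ^ k ≤ 1 := pow_le_one₀ (by norm_num) (by norm_num)
  nlinarith [N.nonneg x]

theorem exists_ball_subset {V : Set G} (hV1 : V ∈ 𝓝 (1 : G)) : ∃ m > 0, N.ball 1 m ⊆ V := by
  obtain ⟨W, hW1, hWV, hW⟩ := local_compact_nhds hV1
  obtain ⟨m, hm, h⟩ := N.exists_ball_subset_of_isCompact hW hW1
  exact ⟨m, hm, h.trans hWV⟩

theorem exists_isCompact_ball_one_subset (R : ℝ) : ∃ K, IsCompact K ∧ N.ball 1 R ⊆ K := by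
  obtain ⟨V, hV, hV1⟩ := exists_compact_mem_nhds (1 : G)
  obtain ⟨m, hm, h⟩ := N.exists_ball_subset_of_isCompact hV hV1
  -- `|R| + 1` keeps the dilation factor positive for every real `R`.
  have hr : 0 < (|R| + 1) / m := by positivity
  refine ⟨H.δ ((|R| + 1) / m) '' V, hV.image (H.contMDiff_δ _ hr).continuous, ?_⟩
  refine Subset.trans ?_ (image_mono h)
  rw [N.image_δ_ball_one hr, div_mul_cancel₀ _ hm.ne']
  exact N.ball_mono 1 (by linarith [le_abs_self R])

/-- The quasi-triangle inequality. -/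
theorem exists_toFun_mul_le :
    ∃ K : ℝ, 1 ≤ K ∧ ∀ x y, N.toFun (x * y) ≤ K * max (N.toFun x) (N.toFun y) := by
  -- Dilating by `r⁻¹` brings both factors to quasi-norm at most 1, hence into the open ball of
  -- radius 2 and its compact hull, on which the quasi-norm of a product is bounded.
  obtain ⟨S, hS, hsub⟩ := N.exists_isCompact_ball_one_subset 2
  obtain ⟨M, hM⟩ := (hS.prod hS).bddAbove_image (f := fun p : G × G ↦ N.toFun (p.1 * p.2))
    (N.continuous_toFun.comp continuous_mul).continuousOn
  refine ⟨max M 1, le_max_right _ _, fun x y ↦ ?_⟩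
  set r := max (N.toFun x) (N.toFun y) with hrdef
  have hr0 : 0 ≤ r := le_max_of_le_left (N.nonneg x)
  rcases hr0.eq_or_lt with h0 | hr
  · have hx : x = 1 := (N.definite x).1 (le_antisymm ((le_max_left _ _).trans h0.ge) (N.nonneg x))
    have hy : y = 1 := (N.definite y).1 (le_antisymm ((le_max_right _ _).trans h0.ge) (N.nonneg y))
    rw [hx, hy, mul_one, N.map_one, ← h0, mul_zero]
  · have hi : 0 < r⁻¹ := inv_pos.2 hr
    have key : ∀ z, N.toFun z ≤ r → H.δ r⁻¹ z ∈ S := fun z hz ↦ hsub <| by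
      rw [mem_ball_one, N.homogeneous _ hi, inv_mul_eq_div, div_lt_iff₀ hr]
      linarith
    have hle : N.toFun (H.δ r⁻¹ x * H.δ r⁻¹ y) ≤ M := hM
      ⟨(H.δ r⁻¹ x, H.δ r⁻¹ y), ⟨key x (le_max_left _ _), key y (le_max_right _ _)⟩, rfl⟩
    rw [← map_mul, N.homogeneous _ hi, inv_mul_eq_div, div_le_iff₀ hr] at hle
    exact hle.trans (mul_le_mul_of_nonneg_right (le_max_left _ _) hr.le)

end LocallyCompact

end QuasiNorm

end HomogeneousStructure

/-! ### Haar measure of quasi-balls. -/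

namespace HomogeneousStructure

variable {E : Type*} [NormedAddCommGroup E] [NormedSpace ℝ E] [FiniteDimensional ℝ E]
  {G : Type*} [TopologicalSpace G] [ChartedSpace E G] [Group G]

namespace QuasiNorm

variable {H : HomogeneousStructure E G} (N : H.QuasiNorm)

theorem measure_ball_pos [IsTopologicalGroup G] [MeasurableSpace G] (μ : Measure G)
    [μ.IsHaarMeasure] (x : G) {r : ℝ} (hr : 0 < r) : 0 < μ (N.ball x r) :=
  (N.isOpen_ball x r).measure_pos μ ⟨x, N.self_mem_ball x hr⟩

section Measure

variable [IsTopologicalGroup G] [MeasurableSpace G] [BorelSpace G]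
  (μ : Measure G) [μ.IsHaarMeasure]

theorem measurableSet_ball (x : G) (r : ℝ) : MeasurableSet (N.ball x r) :=
  (N.isOpen_ball x r).measurableSet

theorem measure_ball (x : G) (r : ℝ) : μ (N.ball x r) = μ (N.ball 1 r) := by
  rw [N.ball_eq_preimage, measure_preimage_mul]

variable [T2Space G] [SecondCountableTopology G] [LocallyCompactSpace G]

/-- Uniqueness of Haar measure under an automorphism of the topological group; the factor is not yet
related to `r ^ Q`. -/
theorem _root_.HomogeneousStructure.exists_measure_image_δ (H : HomogeneousStructure E G)
    {r : ℝ} (hr : 0 < r) : ∃ c : ℝ≥0, 0 < c ∧ ∀ S, μ (H.δ r '' S) = c * μ S := by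
  refine ⟨mulEquivHaarChar (H.dilation r hr), mulEquivHaarChar_pos _, fun S ↦ ?_⟩
  rw [← mulEquivHaarChar_smul_preimage μ (H.dilation r hr), coe_dilation,
    preimage_image_eq _ (H.δ r).injective]
  rfl

theorem measure_ball_lt_top [PathConnectedSpace G] (x : G) (r : ℝ) : μ (N.ball x r) < ⊤ := by
  obtain ⟨S, hS, h⟩ := N.exists_isCompact_ball_one_subset r
  rw [N.measure_ball]
  exact (measure_mono h).trans_lt hS.measure_lt_top

theorem measure_ball_mul {r : ℝ} (hr : 0 < r) (s : ℝ) :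
    μ (N.ball 1 (r * s)) * μ (N.ball 1 1) = μ (N.ball 1 r) * μ (N.ball 1 s) := by
  obtain ⟨c, -, hc⟩ := H.exists_measure_image_δ μ hr
  have h1 := hc (N.ball 1 1)
  rw [N.image_δ_ball_one hr, mul_one] at h1
  rw [← N.image_δ_ball_one hr, hc, h1]
  ring

end Measure

end QuasiNorm

end HomogeneousStructure

/-! ### Volume in a chart at the identity. -/

theorem ContinuousLinearMap.exp_apply_of_eigenvector {E : Type*} [NormedAddCommGroup E]
    [NormedSpace ℝ E] [CompleteSpace E] (B : E →L[ℝ] E) {v : E} {c : ℝ} (h : B v = c • v) :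
    NormedSpace.exp B v = Real.exp c • v := by
  have h1 := (NormedSpace.exp_series_hasSum_exp' (𝕂 := ℝ) B).mapL (ContinuousLinearMap.apply ℝ E v)
  have hpow : ∀ n : ℕ, (B ^ n) v = c ^ n • v := fun n ↦ by
    induction n with
    | zero => simp
    | succ n ih => rw [pow_succ', mul_apply_eq_comp, ih, map_smul, h, smul_smul, pow_succ]
  have h2 := (NormedSpace.exp_series_hasSum_exp' (𝕂 := ℝ) c).smul_const v
  rw [← Real.exp_eq_exp_ℝ] at h2
  refine h1.unique ?_
  convert h2 using 2 with n
  simp [hpow, smul_smul]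

theorem LinearMap.toMatrix_eq_diagonal_of_eigenbasis {ι R M : Type*} [Fintype ι] [DecidableEq ι]
    [CommRing R] [AddCommGroup M] [Module R M] (b : Module.Basis ι R M) {f : M →ₗ[R] M}
    {ν : ι → R} (h : ∀ i, f (b i) = ν i • b i) :
    LinearMap.toMatrix b b f = Matrix.diagonal ν := by
  ext i j
  rw [LinearMap.toMatrix_apply, h, map_smul, b.repr_self, Matrix.diagonal_apply]
  rcases eq_or_ne i j with rfl | hij
  · simp
  · simp [hij]

/-- Multiplication is C¹ near `(1, 1)`, hence Lipschitz there. The constant is uniform in `g`, so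
translations near `1` distort chart volume by a bounded factor. -/
theorem LieGroup.exists_lipschitzOnWith_mul_chart {E : Type*} [NormedAddCommGroup E]
    [NormedSpace ℝ E] {G : Type*} [TopologicalSpace G] [ChartedSpace E G] [Group G]
    [LieGroup 𝓘(ℝ, E) ∞ G] :
    ∃ K : ℝ≥0, ∃ W ∈ 𝓝 (1 : G), ∀ g ∈ W, LipschitzOnWith K
      (fun u ↦ chartAt E (1 : G) (g * (chartAt E (1 : G)).symm u))
      (chartAt E (1 : G) '' (W ∩ (chartAt E (1 : G)).source)) := by
  set ψ := chartAt E (1 : G) with hψ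
  have hm := contMDiff_mul 𝓘(ℝ, E) ∞ (G := G) (1, 1)
  have hc := (contMDiffAt_iff_of_mem_source (y := (1 : G)) (mem_chart_source _ ((1, 1) : G × G))
    (by simp)).1 hm
  have hc2 : ContDiffAt ℝ ∞ (fun p : E × E ↦ ψ (ψ.symm p.1 * ψ.symm p.2)) (ψ 1, ψ 1) := by
    have := hc.2
    simp only [mfld_simps] at this
    rw [Prod.map_id, range_id, contDiffWithinAt_univ] at this
    exact this
  obtain ⟨K, t, ht, hK⟩ := (hc2.of_le (m := 1) (by simp)).exists_lipschitzOnWith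
  have h1 : ψ.source ∈ 𝓝 (1 : G) := chart_source_mem_nhds E 1
  have hcont : ContinuousAt ψ (1 : G) := ψ.continuousAt (mem_chart_source E 1)
  have ht' : (fun p : G × G ↦ (ψ p.1, ψ p.2)) ⁻¹' t ∈ 𝓝 ((1 : G), (1 : G)) := by
    have hc3 : ContinuousAt (fun p : G × G ↦ (ψ p.1, ψ p.2)) (1, 1) :=
      hcont.prodMap hcont
    exact hc3.preimage_mem_nhds ht
  rw [nhds_prod_eq, mem_prod_self_iff] at ht'
  obtain ⟨W, hW, hWt⟩ := ht'
  refine ⟨K, W ∩ ψ.source, inter_mem hW h1, ?_⟩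
  rintro g ⟨hg, hgs⟩ _ ⟨x, ⟨⟨hx, -⟩, hxs⟩, rfl⟩ _ ⟨y, ⟨⟨hy, -⟩, hys⟩, rfl⟩
  have := hK (hWt (mk_mem_prod hg hx)) (hWt (mk_mem_prod hg hy))
  simpa [Prod.edist_eq, ψ.left_inv hgs] using this

namespace HomogeneousStructure

variable {E : Type*} [NormedAddCommGroup E] [NormedSpace ℝ E] [FiniteDimensional ℝ E]
  {G : Type*} [TopologicalSpace G] [ChartedSpace E G] [Group G]

/-- In an eigenbasis of `A` the dilation is diagonal with entries `r ^ ν i`, and the `ν i` sum to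
the trace. -/
theorem det_lieAlgebraDilation (H : HomogeneousStructure E G) {r : ℝ} (hr : 0 < r) :
    ContinuousLinearMap.det (lieAlgebraDilation H.A r : E →L[ℝ] E) = r ^ H.homDim := by
  have : CompleteSpace E := FiniteDimensional.complete ℝ E
  obtain ⟨b, ν, hb⟩ := H.exists_eigenbasis
  let b' : Module.Basis (Fin (Module.finrank ℝ E)) ℝ E := b
  let B : E →L[ℝ] E := H.A
  have hB : ∀ i, B (b' i) = ν i • b' i := fun i ↦ (hb i).2
  have hD : ∀ i, (NormedSpace.exp (Real.log r • B) : E →L[ℝ] E) (b' i) =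
      Real.exp (Real.log r * ν i) • b' i := fun i ↦
    ContinuousLinearMap.exp_apply_of_eigenvector _ (by
      rw [smul_apply, hB, smul_smul])
  have htr : H.homDim = ∑ i, ν i := by
    change LinearMap.trace ℝ E B.toLinearMap = _
    rw [LinearMap.trace_eq_matrix_trace ℝ b',
      LinearMap.toMatrix_eq_diagonal_of_eigenbasis b' (ν := ν) hB, Matrix.trace_diagonal]
  change LinearMap.det (NormedSpace.exp (Real.log r • B) : E →L[ℝ] E).toLinearMap = _
  rw [← LinearMap.det_toMatrix b', LinearMap.toMatrix_eq_diagonal_of_eigenbasis b' hD,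
    Matrix.det_diagonal, htr, Real.rpow_def_of_pos hr, Finset.mul_sum, Real.exp_sum]

variable [LieGroup 𝓘(ℝ, E) ∞ G]

theorem hasStrictFDerivAt_δ_chart (H : HomogeneousStructure E G) {r : ℝ} (hr : 0 < r) :
    HasStrictFDerivAt (chartAt E (1 : G) ∘ H.δ r ∘ (chartAt E (1 : G)).symm)
      (lieAlgebraDilation H.A r : E →L[ℝ] E) (chartAt E (1 : G) 1) := by
  have hc := (contMDiffAt_iff_of_mem_source (y := (1 : G)) (mem_chart_source E (1 : G))
    (by rw [map_one]; exact mem_chart_source E (1 : G))).1 (H.contMDiff_δ r hr 1)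
  have hc2 : ContDiffAt ℝ ∞ (chartAt E (1 : G) ∘ H.δ r ∘ (chartAt E (1 : G)).symm)
      (chartAt E (1 : G) 1) := by
    simpa [mfld_simps, contDiffWithinAt_univ] using hc.2
  have hs := hc2.hasStrictFDerivAt (by simp)
  have hmd : MDifferentiableAt 𝓘(ℝ, E) 𝓘(ℝ, E) (H.δ r) 1 :=
    (H.contMDiff_δ r hr 1).mdifferentiableAt (by simp)
  have hder : fderiv ℝ (chartAt E (1 : G) ∘ H.δ r ∘ (chartAt E (1 : G)).symm)
      (chartAt E (1 : G) 1) = (lieAlgebraDilation H.A r : E →L[ℝ] E) := by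
    ext X
    refine Eq.trans ?_ (H.mfderiv_δ r hr X)
    simp only [mfderiv, hmd, writtenInExtChartAt, map_one]
    simp [mfld_simps, fderivWithin_univ]
    rfl
  rwa [hder] at hs

end HomogeneousStructure

section Chart

variable {E : Type*} [NormedAddCommGroup E] [NormedSpace ℝ E] [FiniteDimensional ℝ E]
  [MeasurableSpace E] [BorelSpace E]
  {G : Type*} [TopologicalSpace G] [ChartedSpace E G] [Group G] [LieGroup 𝓘(ℝ, E) ∞ G]

/-- Strict differentiability makes `δ r` close to `D_r` near `1`, so its volume distortion there
stays below any `m` exceeding the determinant. -/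
theorem HomogeneousStructure.exists_addHaar_chart_image_δ_le (l : Measure E) [l.IsAddHaarMeasure]
    (H : HomogeneousStructure E G) {r : ℝ} (hr : 0 < r) {m : ℝ≥0}
    (hm : ENNReal.ofReal (r ^ H.homDim) < m) :
    ∃ W ∈ 𝓝 (1 : G), ∀ S ⊆ W,
      l (chartAt E (1 : G) '' (H.δ r '' S)) ≤ m * l (chartAt E (1 : G) '' S) := by
  set ψ := chartAt E (1 : G) with hψ
  have hdet : ENNReal.ofReal |ContinuousLinearMap.det (lieAlgebraDilation H.A r : E →L[ℝ] E)| < m := by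
    rwa [H.det_lieAlgebraDilation hr, abs_of_nonneg (Real.rpow_nonneg hr.le _)]
  obtain ⟨c, hc, hc0⟩ :=
    ((addHaar_image_le_mul_of_det_lt l _ hdet).and self_mem_nhdsWithin).exists
  obtain ⟨t, ht, happ⟩ :=
    (H.hasStrictFDerivAt_δ_chart hr).approximates_deriv_on_nhds (Or.inr hc0)
  refine ⟨ψ.source ∩ ψ ⁻¹' t, inter_mem (chart_source_mem_nhds E 1)
    ((ψ.continuousAt (mem_chart_source E 1)).preimage_mem_nhds ht), fun S hS ↦ ?_⟩
  have himg : (ψ ∘ H.δ r ∘ ψ.symm) '' (ψ '' S) = ψ '' (H.δ r '' S) := by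
    simp only [image_image, Function.comp_apply]
    exact image_congr fun x hx ↦ by rw [ψ.left_inv (hS hx).1]
  rw [← himg]
  exact hc _ _ (happ.mono_set (by rintro _ ⟨x, hx, rfl⟩; exact (hS hx).2))

/-- Compute the measure of `T = {(g, u) | g⁻¹ * y ∈ S}`, `y` the point with coordinate `u`, in two
ways. For fixed `g` the slice lies in the chart image of `g * S`, of volume at most `K ^ dim` times
that of `S`; for fixed `u` it contains `y * S`, of Haar measure `μ S`. No density of `μ` is needed.
-/
theorem LieGroup.exists_haar_le_mul_chart [T2Space G] [SecondCountableTopology G]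
    [MeasurableSpace G] [BorelSpace G] (μ : Measure G) [μ.IsHaarMeasure] :
    ∃ C : ℝ≥0∞, C ≠ ⊤ ∧ ∃ W ∈ 𝓝 (1 : G), ∀ S ⊆ W, IsOpen S → S⁻¹ = S →
      μ S ≤ C * μH[Module.finrank ℝ E] (chartAt E (1 : G) '' S) ∧
      μH[Module.finrank ℝ E] (chartAt E (1 : G) '' S) < ⊤ := by
  have : IsTopologicalGroup G := topologicalGroup_of_lieGroup 𝓘(ℝ, E) ∞
  have : LocallyCompactSpace G := ChartedSpace.locallyCompactSpace E G
  set ψ := chartAt E (1 : G) with hψ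
  set l : Measure E := μH[Module.finrank ℝ E] with hl
  obtain ⟨K, W₀, hW₀, hK⟩ := LieGroup.exists_lipschitzOnWith_mul_chart (E := E) (G := G)
  have hsrc : ψ.source ∈ 𝓝 (1 : G) := chart_source_mem_nhds E 1
  obtain ⟨W₂, hW₂1, hW₂, hW₂c⟩ := local_compact_nhds (inter_mem hW₀ hsrc)
  have hW₂s : W₂ ⊆ ψ.source := hW₂.trans inter_subset_right
  obtain ⟨V, hVo, hV1, hVV⟩ := exists_open_nhds_one_mul_subset (interior_mem_nhds.2 hW₂1)
  have hVW : V ⊆ interior W₂ := fun x hx ↦ hVV ⟨x, hx, 1, hV1, mul_one x⟩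
  have hVs : V ⊆ ψ.source := hVW.trans (interior_subset.trans hW₂s)
  have hfin : ∀ S ⊆ V, l (ψ '' S) < ⊤ := fun S hS ↦
    (measure_mono (image_mono (hS.trans (hVW.trans interior_subset)))).trans_lt
      (hW₂c.image_of_continuousOn (ψ.continuousOn.mono hW₂s)).measure_lt_top
  have hVpos : 0 < l (ψ '' V) :=
    (ψ.isOpen_image_of_subset_source hVo hVs).measure_pos l ⟨_, 1, hV1, rfl⟩
  refine ⟨K ^ (Module.finrank ℝ E : ℝ) * μ (interior W₂) / l (ψ '' V),
    ENNReal.div_ne_top (ENNReal.mul_ne_top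
      (ENNReal.rpow_ne_top_of_nonneg (by positivity) ENNReal.coe_ne_top)
      ((measure_mono interior_subset).trans_lt hW₂c.measure_lt_top).ne) hVpos.ne', V,
    hVo.mem_nhds hV1, fun S hS hSo hSi ↦ ⟨?_, hfin S hS⟩⟩
  set T : Set (G × E) := (interior W₂ ×ˢ ψ.target) ∩
    {p | ψ.symm p.2 ∈ V ∧ p.1⁻¹ * ψ.symm p.2 ∈ S} with hT
  have hTo : IsOpen T := by
    have hc1 : ContinuousOn (fun p : G × E ↦ ψ.symm p.2) (interior W₂ ×ˢ ψ.target) :=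
      ψ.continuousOn_symm.comp continuousOn_snd fun p hp ↦ hp.2
    have hc2 : ContinuousOn (fun p : G × E ↦ (ψ.symm p.2, p.1⁻¹ * ψ.symm p.2))
        (interior W₂ ×ˢ ψ.target) := hc1.prodMk (continuousOn_fst.inv.mul hc1)
    exact hc2.isOpen_inter_preimage (isOpen_interior.prod ψ.open_target) (hVo.prod hSo)
  have hle : (μ.prod l) T ≤ K ^ (Module.finrank ℝ E : ℝ) * l (ψ '' S) * μ (interior W₂) := by
    rw [Measure.prod_apply hTo.measurableSet, ← setLIntegral_const,
      ← lintegral_indicator isOpen_interior.measurableSet]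
    refine lintegral_mono fun g ↦ ?_
    by_cases hg : g ∈ interior W₂
    · rw [indicator_of_mem hg]
      have hLip := (hK g (hW₂ (interior_subset hg)).1).mono (image_mono (s := S)
        fun x hx ↦ hW₂ (interior_subset (hVW (hS hx))))
      refine (measure_mono ?_).trans (hLip.hausdorffMeasure_image_le (by positivity))
      rintro u ⟨⟨-, hu⟩, huV, huS⟩
      refine ⟨ψ (g⁻¹ * ψ.symm u), ⟨_, huS, rfl⟩, ?_⟩
      simp only [← hψ]
      rw [ψ.left_inv (hVs (hS huS)), mul_inv_cancel_left, ψ.right_inv hu]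
    · rw [show Prod.mk g ⁻¹' T = ∅ from eq_empty_of_forall_notMem fun u hu ↦ hg hu.1.1]
      simp
  have hge : μ S * l (ψ '' V) ≤ (μ.prod l) T := by
    rw [Measure.prod_apply_symm hTo.measurableSet, ← setLIntegral_const,
      ← lintegral_indicator (ψ.isOpen_image_of_subset_source hVo hVs).measurableSet]
    refine lintegral_mono fun u ↦ ?_
    by_cases hu : u ∈ ψ '' V
    · rw [indicator_of_mem hu]
      obtain ⟨y, hy, rfl⟩ := hu
      have hys := hVs hy
      rw [← measure_preimage_mul μ y⁻¹ S]
      refine measure_mono fun g hg ↦ ?_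
      have hg' : y⁻¹ * g ∈ S := hg
      refine ⟨⟨hVV ⟨y, hy, _, hS hg', mul_inv_cancel_left y g⟩, ψ.map_source hys⟩, ?_⟩
      simp only [mem_ofPred_eq, ψ.left_inv hys]
      refine ⟨hy, ?_⟩
      -- Symmetry of `S` is what makes the slice a left translate of `S` rather than of `S⁻¹`.
      rw [← hSi, Set.mem_inv]
      simpa using hg'
    · simp [indicator_of_notMem hu]
  rw [ENNReal.mul_div_right_comm.symm, ENNReal.le_div_iff_mul_le (Or.inl hVpos.ne')
    (Or.inl (hfin V subset_rfl).ne)]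
  refine (hge.trans hle).trans_eq (by ring)

end Chart

/-! ### Upper volume bound for small quasi-balls. -/

namespace HomogeneousStructure.QuasiNorm

variable {E : Type*} [NormedAddCommGroup E] [NormedSpace ℝ E] [FiniteDimensional ℝ E]
  {G : Type*} [TopologicalSpace G] [ChartedSpace E G] [Group G] [LieGroup 𝓘(ℝ, E) ∞ G]
  [T2Space G] [SecondCountableTopology G] [PathConnectedSpace G]
  [MeasurableSpace G] [BorelSpace G]
  {H : HomogeneousStructure E G} (N : H.QuasiNorm) (μ : Measure G) [μ.IsHaarMeasure]

/-- If the Haar factor `c` exceeded some `a > r ^ Q`, iterating `δ r` on a small ball would multiply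
Haar measure by `c ^ n` and chart volume by at most `a ^ n`. The bound of the former by `C` times
the latter then fails for large `n`, whatever `C` is. -/
theorem measure_ball_le_rpow_mul {r : ℝ} (hr : 0 < r) (hr1 : r ≤ 1) :
    μ (N.ball 1 r) ≤ ENNReal.ofReal (r ^ H.homDim) * μ (N.ball 1 1) := by
  borelize E
  have : IsTopologicalGroup G := topologicalGroup_of_lieGroup 𝓘(ℝ, E) ∞
  have : LocallyCompactSpace G := ChartedSpace.locallyCompactSpace E G
  obtain ⟨c, hc0, hc⟩ := H.exists_measure_image_δ μ hr
  have h1 := hc (N.ball 1 1)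
  rw [N.image_δ_ball_one hr, mul_one] at h1
  rw [h1]
  refine mul_le_mul_left (le_of_forall_gt_imp_ge_of_dense fun a ha ↦ ?_) _
  rcases eq_or_ne a ⊤ with rfl | hat
  · exact le_top
  lift a to ℝ≥0 using hat
  obtain ⟨W₁, hW₁, hδ⟩ := H.exists_addHaar_chart_image_δ_le μH[Module.finrank ℝ E] hr ha
  obtain ⟨C, hC, W₂, hW₂, hμ⟩ := LieGroup.exists_haar_le_mul_chart (E := E) μ
  obtain ⟨s, hs, hsub⟩ := N.exists_ball_subset (inter_mem hW₁ hW₂)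
  set l : Set G → ℝ≥0∞ := fun S ↦ μH[Module.finrank ℝ E] (chartAt E (1 : G) '' S) with hl
  set B : ℕ → Set G := fun n ↦ N.ball 1 (r ^ n * s) with hB
  have hB0 : B 0 = N.ball 1 s := by simp [hB]
  have hBs : ∀ n, B (n + 1) = H.δ r '' B n := fun n ↦ by
    rw [N.image_δ_ball_one hr, ← mul_assoc, ← pow_succ']
  have hBW : ∀ n, B n ⊆ W₁ ∩ W₂ := fun n ↦ (N.ball_mono 1
    (mul_le_of_le_one_left hs.le (pow_le_one₀ hr.le hr1))).trans hsub
  have hμB : ∀ n, μ (B n) = c ^ n * μ (B 0) := fun n ↦ by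
    induction n with
    | zero => simp
    | succ n ih => rw [hBs, hc, ih]; ring
  have hlB : ∀ n, l (B n) ≤ a ^ n * l (B 0) := fun n ↦ by
    induction n with
    | zero => simp
    | succ n ih =>
      rw [hBs]
      refine (hδ _ ((hBW n).trans inter_subset_left)).trans ?_
      refine (mul_le_mul_right ih _).trans_eq (by ring)
  have hμl : ∀ n, μ (B n) ≤ C * l (B n) ∧ l (B n) < ⊤ := fun n ↦
    hμ _ ((hBW n).trans inter_subset_right) (N.isOpen_ball _ _) (N.inv_ball_one _)
  by_contra! hac
  have hc' : (c : ℝ≥0∞) ≠ 0 := by exact_mod_cast hc0.ne'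
  have hlt : (a : ℝ≥0∞) / c < 1 := (ENNReal.div_lt_iff (Or.inl hc') (Or.inl ENNReal.coe_ne_top)).2
    (by simpa using hac)
  have hle : ∀ n : ℕ, μ (B 0) ≤ C * l (B 0) * ((a : ℝ≥0∞) / c) ^ n := fun n ↦ by
    have hcn0 : (c : ℝ≥0∞) ^ n ≠ 0 := pow_ne_zero n hc'
    have hcnt : (c : ℝ≥0∞) ^ n ≠ ⊤ := ENNReal.pow_ne_top ENNReal.coe_ne_top
    rw [div_eq_mul_inv, mul_pow, ← ENNReal.inv_pow, ← mul_assoc, ← div_eq_mul_inv,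
      ENNReal.le_div_iff_mul_le (Or.inl hcn0) (Or.inl hcnt)]
    calc μ (B 0) * c ^ n = μ (B n) := by rw [hμB n, mul_comm]
      _ ≤ C * l (B n) := (hμl n).1
      _ ≤ C * (a ^ n * l (B 0)) := mul_le_mul_right (hlB n) _
      _ = _ := by ring
  have hlim : Tendsto (fun n : ℕ ↦ C * l (B 0) * ((a : ℝ≥0∞) / c) ^ n) atTop
      (𝓝 (C * l (B 0) * 0)) := ENNReal.Tendsto.const_mul
    (ENNReal.tendsto_pow_atTop_nhds_zero_of_lt_one hlt)
    (Or.inr (ENNReal.mul_ne_top hC (hμl 0).2.ne))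
  rw [mul_zero] at hlim
  refine (ge_of_tendsto' hlim hle).not_gt ?_
  rw [hB0]
  exact N.measure_ball_pos μ 1 hs

end HomogeneousStructure.QuasiNorm

/-! ### Layer-cake formulas with values in `[0, ∞]`. -/

section LayerCake

theorem ENNReal.rpow_eq_lintegral_indicator (a : ℝ≥0∞) {q : ℝ} (hq : 0 < q) :
    a ^ q = ENNReal.ofReal q * ∫⁻ t in Ioi (0 : ℝ),
      {t : ℝ | ENNReal.ofReal t < a}.indicator (fun t ↦ ENNReal.ofReal (t ^ (q - 1))) t := by
  have key : ∀ b : ℝ≥0, (b : ℝ≥0∞) ^ q = ENNReal.ofReal q * ∫⁻ t in Ioi (0 : ℝ),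
      {t : ℝ | ENNReal.ofReal t < b}.indicator (fun t ↦ ENNReal.ofReal (t ^ (q - 1))) t := by
    intro b
    -- The layer-cake formula for the constant `b` over a one-point space.
    have h := lintegral_rpow_eq_lintegral_meas_lt_mul (Measure.dirac ()) (f := fun _ ↦ (b : ℝ))
      (ae_of_all _ fun _ ↦ b.2) measurable_const.aemeasurable hq
    rw [lintegral_dirac, ← ENNReal.ofReal_rpow_of_nonneg (NNReal.coe_nonneg b) hq.le, ENNReal.ofReal_coe_nnreal] at h
    rw [h]
    congr 1
    refine setLIntegral_congr_fun measurableSet_Ioi fun t ht ↦ ?_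
    have hiff : ENNReal.ofReal t < b ↔ t < b := by
      rw [← ENNReal.ofReal_coe_nnreal, ENNReal.ofReal_lt_ofReal_iff_of_nonneg (le_of_lt ht)]
    by_cases htb : t < b
    · simp [indicator, hiff, htb]
    · simp [indicator, hiff, htb]
  induction a with
  | coe b => exact key b
  | top =>
    rw [ENNReal.top_rpow_of_pos hq, eq_comm, eq_top_iff]
    have hlim : Tendsto (fun n : ℕ ↦ ((n : ℝ≥0) : ℝ≥0∞) ^ q) atTop (𝓝 ⊤) := by
      have h := (ENNReal.continuous_rpow_const (y := q)).tendsto ⊤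
      rw [ENNReal.top_rpow_of_pos hq] at h
      exact h.comp (by simpa using ENNReal.tendsto_nat_nhds_top)
    refine ge_of_tendsto' (x := atTop) tendsto_const_nhds fun _ : ℕ ↦ ?_
    refine le_of_tendsto' hlim fun n ↦ ?_
    rw [key]
    exact mul_le_mul_right (lintegral_mono fun t ↦ indicator_le_indicator_of_subset
      (fun t (ht : ENNReal.ofReal t < _) ↦ lt_of_lt_of_le ht le_top) (fun _ ↦ zero_le) t) _

/-- Tonelli and the pointwise formula. Weight `1` serves the maximal function, weight `g` the
integrated weak-type bound. -/
theorem MeasureTheory.lintegral_mul_rpow_eq_lintegral_setLIntegral {α : Type*} [MeasurableSpace α]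
    (μ : Measure α) [SFinite μ] {w g : α → ℝ≥0∞} (hw : Measurable w) (hg : Measurable g) {q : ℝ}
    (hq : 0 < q) :
    ∫⁻ x, w x * g x ^ q ∂μ = ENNReal.ofReal q * ∫⁻ t in Ioi (0 : ℝ),
      ENNReal.ofReal (t ^ (q - 1)) * ∫⁻ x in {x | ENNReal.ofReal t < g x}, w x ∂μ := by
  set S : Set (α × ℝ) := {p | ENNReal.ofReal p.2 < g p.1} with hS
  have hSm : MeasurableSet S := measurableSet_lt (by fun_prop) (by fun_prop)
  set k : α → ℝ → ℝ≥0∞ := fun x t ↦ w x * S.indicator (fun p ↦ ENNReal.ofReal (p.2 ^ (q - 1))) (x, t)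
    with hk
  have hkm : Measurable (Function.uncurry k) := by
    refine (hw.comp measurable_fst).mul (Measurable.indicator ?_ hSm)
    fun_prop
  calc ∫⁻ x, w x * g x ^ q ∂μ
      = ∫⁻ x, ENNReal.ofReal q * (∫⁻ t in Ioi (0 : ℝ), k x t) ∂μ := by
        refine lintegral_congr fun x ↦ ?_
        rw [ENNReal.rpow_eq_lintegral_indicator _ hq, lintegral_const_mul]
        · rw [mul_left_comm]; rfl
        · exact (Measurable.indicator (f := fun p : α × ℝ ↦ ENNReal.ofReal (p.2 ^ (q - 1)))
            (by fun_prop) hSm).comp measurable_prodMk_left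
    _ = ENNReal.ofReal q * ∫⁻ x, (∫⁻ t in Ioi (0 : ℝ), k x t) ∂μ :=
        lintegral_const_mul _ hkm.lintegral_prod_right'
    _ = ENNReal.ofReal q * ∫⁻ t in Ioi (0 : ℝ), ∫⁻ x, k x t ∂μ := by
        rw [lintegral_lintegral_swap hkm.aemeasurable]
    _ = _ := by
        congr 1
        refine lintegral_congr fun t ↦ ?_
        have hm : MeasurableSet {x | ENNReal.ofReal t < g x} := measurableSet_lt measurable_const hg
        rw [← lintegral_indicator hm, ← lintegral_const_mul _ (hw.indicator hm)]
        refine lintegral_congr fun x ↦ ?_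
        by_cases hx : ENNReal.ofReal t < g x
        · simp [hk, hS, indicator, hx, mul_comm]
        · simp [hk, hS, indicator, hx]

end LayerCake

/-! ### Weak and strong type bounds for the maximal function. -/

namespace HomogeneousStructure.QuasiNorm

variable {E : Type*} [NormedAddCommGroup E] [NormedSpace ℝ E] [FiniteDimensional ℝ E]
  {G : Type*} [TopologicalSpace G] [ChartedSpace E G] [Group G]
  {H : HomogeneousStructure E G} (N : H.QuasiNorm)

/-- Two uses of the quasi-triangle inequality through a common point. The factor 2 between radii is
the one of the Vitali selection. -/
theorem ball_subset_ball {K : ℝ} (hK1 : 1 ≤ K)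
    (hK : ∀ x y, N.toFun (x * y) ≤ K * max (N.toFun x) (N.toFun y)) {z w : G} {t s : ℝ}
    (hts : t ≤ 2 * s) (hne : (N.ball z t ∩ N.ball w s).Nonempty) :
    N.ball z t ⊆ N.ball w (2 * K ^ 2 * s) := by
  obtain ⟨u, hu1, hu2⟩ := hne
  intro y hy
  rw [mem_ball] at *
  have hu1' : N.toFun (u⁻¹ * z) < t := by
    rw [← N.symmetric]; simpa using hu1
  have hs : 0 < s := (N.nonneg _).trans_lt hu2
  have h1 : N.toFun (u⁻¹ * y) ≤ K * t := by
    have := hK (u⁻¹ * z) (z⁻¹ * y)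
    rw [mul_assoc, mul_inv_cancel_left] at this
    exact this.trans (mul_le_mul_of_nonneg_left (max_le hu1'.le hy.le) (by linarith))
  have h1' : N.toFun (u⁻¹ * y) < K * (2 * s) := by
    have := hK (u⁻¹ * z) (z⁻¹ * y)
    rw [mul_assoc, mul_inv_cancel_left] at this
    exact this.trans_lt (mul_lt_mul_of_pos_left ((max_lt hu1' hy).trans_le hts) (by linarith))
  have := hK (w⁻¹ * u) (u⁻¹ * y)
  rw [mul_assoc, mul_inv_cancel_left] at this
  refine this.trans_lt ?_
  rw [show 2 * K ^ 2 * s = K * (K * (2 * s)) by ring]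
  refine mul_lt_mul_of_pos_left (max_lt ?_ h1') (by linarith)
  nlinarith

section Maximal

variable [MeasurableSpace G] (μ : Measure G) {F : Type*} [ENorm F]

theorem lt_maximal_iff {f : G → F} {x : G} {a : ℝ≥0∞} :
    a < N.maximal μ f x ↔ ∃ z r, 0 < r ∧ x ∈ N.ball z r ∧
      a < (μ (N.ball z r))⁻¹ * ∫⁻ y in N.ball z r, ‖f y‖ₑ ∂μ := by
  simp only [maximal, lt_iSup_iff, exists_prop]

theorem le_maximal {f : G → F} {x z : G} {r : ℝ} (hr : 0 < r) (hx : x ∈ N.ball z r) :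
    (μ (N.ball z r))⁻¹ * ∫⁻ y in N.ball z r, ‖f y‖ₑ ∂μ ≤ N.maximal μ f x :=
  le_iSup_of_le z <| le_iSup_of_le r <| le_iSup_of_le hr <| le_iSup_of_le hx le_rfl

theorem maximal_congr_ae {f g : G → ℝ≥0∞} (h : f =ᵐ[μ] g) : N.maximal μ f = N.maximal μ g := by
  ext x
  refine iSup_congr fun z ↦ iSup_congr fun r ↦ iSup_congr fun _ ↦ iSup_congr fun _ ↦
    congrArg _ ?_
  exact lintegral_congr_ae (ae_restrict_of_ae (h.mono fun x hx ↦ show ‖f x‖ₑ = ‖g x‖ₑ by rw [hx]))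

variable [IsTopologicalGroup G] [BorelSpace G]

/-- The supremum is uncentred, so superlevel sets are unions of open balls, whatever `f` is. -/
theorem measurable_maximal (f : G → F) : Measurable (N.maximal μ f) := by
  refine measurable_of_Ioi fun a ↦ IsOpen.measurableSet ?_
  have : N.maximal μ f ⁻¹' Ioi a = ⋃ (z : G) (r : ℝ) (_ : 0 < r ∧
      a < (μ (N.ball z r))⁻¹ * ∫⁻ y in N.ball z r, ‖f y‖ₑ ∂μ), N.ball z r := by
    ext x
    simp only [mem_preimage, mem_Ioi, lt_maximal_iff, mem_iUnion, exists_prop]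
    exact exists_congr fun z ↦ exists_congr fun r ↦ by tauto
  rw [this]
  exact isOpen_iUnion fun z ↦ isOpen_iUnion fun r ↦ isOpen_iUnion fun _ ↦ N.isOpen_ball z r

variable [T2Space G] [SecondCountableTopology G] [LocallyCompactSpace G] [μ.IsHaarMeasure]

/-- Enlarging the radius of a quasi-ball by a fixed factor multiplies its measure by a constant. -/
theorem exists_measure_ball_mul_eq {L : ℝ} (hL : 0 < L) :
    ∃ A : ℝ≥0, ∀ x r, μ (N.ball x (L * r)) = A * μ (N.ball x r) := by
  obtain ⟨c, -, hc⟩ := H.exists_measure_image_δ μ hL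
  refine ⟨c, fun x r ↦ ?_⟩
  rw [N.measure_ball, N.measure_ball μ x r, ← hc, N.image_δ_ball_one hL]

variable [PathConnectedSpace G]

/-- The weak type (1, 1) inequality. -/
theorem exists_mul_measure_lt_maximal_le :
    ∃ A : ℝ≥0, ∀ (f : G → F) (a : ℝ≥0∞),
      a * μ {x | a < N.maximal μ f x} ≤ A * ∫⁻ x, ‖f x‖ₑ ∂μ := by
  obtain ⟨K, hK1, hK⟩ := N.exists_toFun_mul_le
  obtain ⟨A, hA⟩ := N.exists_measure_ball_mul_eq μ (L := 2 * K ^ 2) (by positivity)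
  refine ⟨A, fun f a ↦ ?_⟩
  -- Vitali selection needs bounded radii; the cutoff `R` is removed by monotone convergence.
  set T : ℕ → Set (G × ℝ) := fun R ↦ {b | 0 < b.2 ∧ b.2 ≤ R ∧
    a < (μ (N.ball b.1 b.2))⁻¹ * ∫⁻ y in N.ball b.1 b.2, ‖f y‖ₑ ∂μ} with hT
  set U : ℕ → Set G := fun R ↦ ⋃ b ∈ T R, N.ball b.1 b.2 with hU
  have hUnion : {x | a < N.maximal μ f x} = ⋃ R, U R := by
    ext x
    simp only [mem_ofPred_eq, lt_maximal_iff, hU, mem_iUnion, exists_prop]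
    constructor
    · rintro ⟨z, r, hr, hx, h⟩
      obtain ⟨n, hn⟩ := exists_nat_ge r
      exact ⟨n, (z, r), ⟨hr, hn, h⟩, hx⟩
    · rintro ⟨n, b, ⟨hr, -, h⟩, hx⟩
      exact ⟨b.1, b.2, hr, hx, h⟩
  have hmono : Monotone U := fun m n hmn ↦ biUnion_subset_biUnion_left fun b hb ↦
    ⟨hb.1, hb.2.1.trans (by exact_mod_cast hmn), hb.2.2⟩
  rw [hUnion, hmono.measure_iUnion, ENNReal.mul_iSup]
  refine iSup_le fun R ↦ ?_
  obtain ⟨u, huT, hdisj, hcov⟩ := Vitali.exists_disjoint_subfamily_covering_enlargement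
    (fun b : G × ℝ ↦ N.ball b.1 b.2) (T R) Prod.snd 2 one_lt_two (fun b hb ↦ hb.1.le) R
    (fun b hb ↦ hb.2.1) (fun b hb ↦ ⟨b.1, N.self_mem_ball _ hb.1⟩)
  have hucount : u.Countable := hdisj.countable_of_isOpen (fun b _ ↦ N.isOpen_ball _ _)
    (fun b hb ↦ ⟨b.1, N.self_mem_ball _ (huT hb).1⟩)
  have hsub : U R ⊆ ⋃ b ∈ u, N.ball b.1 (2 * K ^ 2 * b.2) := by
    refine iUnion₂_subset fun b hb ↦ ?_
    obtain ⟨b', hb', hne, hle⟩ := hcov b hb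
    exact (N.ball_subset_ball hK1 hK hle hne).trans
      (subset_biUnion_of_mem (u := fun b : G × ℝ ↦ N.ball b.1 (2 * K ^ 2 * b.2)) hb')
  have hball : ∀ b ∈ u, a * μ (N.ball b.1 b.2) ≤ ∫⁻ y in N.ball b.1 b.2, ‖f y‖ₑ ∂μ := fun b hb ↦ by
    have h := (huT hb).2.2.le
    rw [mul_comm, ← div_eq_mul_inv] at h
    exact ENNReal.mul_le_of_le_div h
  have := hucount.to_subtype
  calc a * μ (U R) ≤ a * ∑' b : u, μ (N.ball b.1.1 (2 * K ^ 2 * b.1.2)) :=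
        mul_le_mul_right ((measure_mono hsub).trans (measure_biUnion_le μ hucount _)) a
    _ = A * ∑' b : u, a * μ (N.ball b.1.1 b.1.2) := by
        simp only [hA, ENNReal.tsum_mul_left]; ring
    _ ≤ A * ∑' b : u, ∫⁻ y in N.ball b.1.1 b.1.2, ‖f y‖ₑ ∂μ := by
        gcongr with b
        exact hball b b.2
    _ = A * ∫⁻ y in ⋃ b ∈ u, N.ball b.1 b.2, ‖f y‖ₑ ∂μ := by
        rw [lintegral_biUnion hucount (fun b _ ↦ N.measurableSet_ball _ _) hdisj]
    _ ≤ A * ∫⁻ x, ‖f x‖ₑ ∂μ := mul_le_mul_right (setLIntegral_le_lintegral _ _) _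

/-- The part of `g` below height `a` has averages at most `a`. -/
theorem maximal_le_maximal_indicator_add (g : G → ℝ≥0∞) (a : ℝ≥0∞) (x : G) :
    N.maximal μ g x ≤ N.maximal μ ({y | a < g y}.indicator g) x + a := by
  refine iSup_le fun z ↦ iSup_le fun r ↦ iSup_le fun hr ↦ iSup_le fun hx ↦ ?_
  have h0 := (N.measure_ball_pos μ z hr).ne'
  have ht := (N.measure_ball_lt_top μ z r).ne
  calc (μ (N.ball z r))⁻¹ * ∫⁻ y in N.ball z r, ‖g y‖ₑ ∂μ
      ≤ (μ (N.ball z r))⁻¹ * ∫⁻ y in N.ball z r, ‖{y | a < g y}.indicator g y‖ₑ + a ∂μ := by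
        gcongr with y
        by_cases hy : a < g y
        · simp [indicator, hy]
        · simpa [indicator, hy] using not_lt.1 hy
    _ = (μ (N.ball z r))⁻¹ * ∫⁻ y in N.ball z r, ‖{y | a < g y}.indicator g y‖ₑ ∂μ + a := by
        rw [lintegral_add_right _ measurable_const, setLIntegral_const, mul_add,
          mul_comm a, ← mul_assoc, ENNReal.inv_mul_cancel h0 ht, one_mul]
    _ ≤ _ := add_le_add_left (N.le_maximal μ hr hx) a

/-- The strong type (p, p) inequality. -/
theorem exists_lintegral_maximal_rpow_le {p : ℝ} (hp : 1 < p) :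
    ∃ A : ℝ≥0, ∀ g : G → ℝ≥0∞, AEMeasurable g μ →
      ∫⁻ x, N.maximal μ g x ^ p ∂μ ≤ A * ∫⁻ x, g x ^ p ∂μ := by
  obtain ⟨A, hA⟩ := N.exists_mul_measure_lt_maximal_le μ (F := ℝ≥0∞)
  have hp0 : 0 < p := by linarith
  have hp1 : 0 < p - 1 := by linarith
  -- `p` comes from the layer cake for `M g`, `2 * A` from weak type at height `t / 2`, and the rest
  -- from the layer cake for `2 * g` with exponent `p - 1`.
  set D : ℝ≥0∞ := ENNReal.ofReal p * (2 * A * ((ENNReal.ofReal (p - 1))⁻¹ * 2 ^ (p - 1))) with hD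
  have hDt : D ≠ ⊤ := by
    refine ENNReal.mul_ne_top ENNReal.ofReal_ne_top (ENNReal.mul_ne_top
      (ENNReal.mul_ne_top ENNReal.ofNat_ne_top ENNReal.coe_ne_top) (ENNReal.mul_ne_top ?_ ?_))
    · simpa using hp
    · exact ENNReal.rpow_ne_top_of_nonneg hp1.le ENNReal.ofNat_ne_top
  suffices h : ∀ g : G → ℝ≥0∞, Measurable g →
      ∫⁻ x, N.maximal μ g x ^ p ∂μ ≤ D * ∫⁻ x, g x ^ p ∂μ by
    refine ⟨D.toNNReal, fun g hg ↦ ?_⟩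
    rw [ENNReal.coe_toNNReal hDt, N.maximal_congr_ae μ hg.ae_eq_mk,
      lintegral_congr_ae (hg.ae_eq_mk.mono fun x hx ↦ show g x ^ p = hg.mk g x ^ p by rw [hx])]
    exact h _ hg.measurable_mk
  intro g hg
  have hdist := lintegral_mul_rpow_eq_lintegral_setLIntegral μ (w := fun _ ↦ 1)
    measurable_const (N.measurable_maximal μ g) hp0
  simp only [one_mul, setLIntegral_one] at hdist
  have hg2 := lintegral_mul_rpow_eq_lintegral_setLIntegral μ (w := g) (g := fun x ↦ 2 * g x)
    hg (hg.const_mul 2) hp1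
  have hpow : ∀ x, g x * (2 * g x) ^ (p - 1) = 2 ^ (p - 1) * g x ^ p := fun x ↦ by
    rw [ENNReal.mul_rpow_of_nonneg _ _ hp1.le, mul_left_comm]
    congr 1
    nth_rw 1 [← ENNReal.rpow_one (g x)]
    rw [← ENNReal.rpow_add_of_nonneg _ _ zero_le_one hp1.le, add_sub_cancel]
  simp only [hpow] at hg2
  rw [lintegral_const_mul _ (hg.pow_const p)] at hg2
  have hlevel : ∀ t ∈ Ioi (0 : ℝ),
      ENNReal.ofReal (t ^ (p - 1)) * μ {x | ENNReal.ofReal t < N.maximal μ g x} ≤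
        2 * A * (ENNReal.ofReal (t ^ (p - 1 - 1)) *
          ∫⁻ x in {x | ENNReal.ofReal t < 2 * g x}, g x ∂μ) := by
    intro t ht
    have ht0 : (0 : ℝ) < t := ht
    have hset : {x | ENNReal.ofReal (t / 2) < g x} = {x | ENNReal.ofReal t < 2 * g x} := by
      ext x
      simp only [mem_ofPred_eq]
      rw [ENNReal.ofReal_div_of_pos two_pos, ENNReal.ofReal_ofNat,
        ENNReal.div_lt_iff (by simp) (by simp), mul_comm]
    have hsplit : ENNReal.ofReal t = ENNReal.ofReal (t / 2) + ENNReal.ofReal (t / 2) := by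
      rw [← ENNReal.ofReal_add (by positivity) (by positivity), add_halves]
    have hweak := hA ({x | ENNReal.ofReal (t / 2) < g x}.indicator g) (ENNReal.ofReal (t / 2))
    simp only [enorm_eq_self] at hweak
    rw [lintegral_indicator (measurableSet_lt measurable_const hg), hset] at hweak
    have hmeas : μ {x | ENNReal.ofReal t < N.maximal μ g x} ≤ μ {x | ENNReal.ofReal (t / 2) <
        N.maximal μ ({x | ENNReal.ofReal t < 2 * g x}.indicator g) x} := by
      refine measure_mono fun x hx ↦ ?_
      have h1 := lt_of_lt_of_le (show ENNReal.ofReal t < _ from hx)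
        (N.maximal_le_maximal_indicator_add μ g (ENNReal.ofReal (t / 2)) x)
      rw [hsplit, hset] at h1
      exact lt_of_add_lt_add_right h1
    have ht2 : ENNReal.ofReal (t ^ (p - 1)) =
        2 * ENNReal.ofReal (t ^ (p - 1 - 1)) * ENNReal.ofReal (t / 2) := by
      rw [← ENNReal.ofReal_ofNat, ← ENNReal.ofReal_mul (by positivity),
        ← ENNReal.ofReal_mul (by positivity)]
      congr 1
      rw [Real.rpow_sub_one ht0.ne' (p - 1)]
      field_simp
    calc ENNReal.ofReal (t ^ (p - 1)) * μ {x | ENNReal.ofReal t < N.maximal μ g x}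
      _ ≤ ENNReal.ofReal (t ^ (p - 1)) * μ {x | ENNReal.ofReal (t / 2) <
          N.maximal μ ({x | ENNReal.ofReal t < 2 * g x}.indicator g) x} :=
          mul_le_mul_right hmeas _
      _ ≤ 2 * ENNReal.ofReal (t ^ (p - 1 - 1)) *
          (A * ∫⁻ x in {x | ENNReal.ofReal t < 2 * g x}, g x ∂μ) := by
          rw [ht2, mul_assoc]; exact mul_le_mul_right hweak _
      _ = _ := by ring
  calc ∫⁻ x, N.maximal μ g x ^ p ∂μ
      ≤ ENNReal.ofReal p * ∫⁻ t in Ioi (0 : ℝ), 2 * A * (ENNReal.ofReal (t ^ (p - 1 - 1)) *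
          ∫⁻ x in {x | ENNReal.ofReal t < 2 * g x}, g x ∂μ) := by
        rw [hdist]
        exact mul_le_mul_right (setLIntegral_mono' measurableSet_Ioi hlevel) _
    _ = D * ∫⁻ x, g x ^ p ∂μ := by
        rw [lintegral_const_mul' _ _ (ENNReal.mul_ne_top ENNReal.ofNat_ne_top ENNReal.coe_ne_top)]
        have hne : ENNReal.ofReal (p - 1) ≠ 0 := by simpa using hp
        rw [← ENNReal.inv_mul_cancel_left' (b := ∫⁻ t in Ioi (0 : ℝ), _)
          (fun h ↦ absurd h hne) (fun h ↦ absurd h ENNReal.ofReal_ne_top), ← hg2, hD]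
        ring

end Maximal

end HomogeneousStructure.QuasiNorm

/-! ### Morrey estimates. -/

theorem MeasureTheory.lintegral_rpow_le_measure_univ_rpow_mul {α : Type*} [MeasurableSpace α]
    (ν : Measure α) {h : α → ℝ≥0∞} (hh : AEMeasurable h ν) {p : ℝ} (hp : 1 ≤ p) :
    (∫⁻ x, h x ∂ν) ^ p ≤ ν univ ^ (p - 1) * ∫⁻ x, h x ^ p ∂ν := by
  have hp0 : 0 < p := by linarith
  have h1 := eLpNorm'_le_eLpNorm'_mul_rpow_measure_univ (μ := ν) one_pos hp
    hh.aestronglyMeasurable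
  simp only [eLpNorm', enorm_eq_self, ENNReal.rpow_one, div_one] at h1
  have h2 := ENNReal.rpow_le_rpow h1 hp0.le
  rw [ENNReal.mul_rpow_of_nonneg _ _ hp0.le, ← ENNReal.rpow_mul, ← ENNReal.rpow_mul,
    one_div_mul_cancel hp0.ne', ENNReal.rpow_one, sub_mul, one_mul, one_div_mul_cancel hp0.ne',
    mul_comm] at h2
  exact h2

namespace HomogeneousStructure.QuasiNorm

variable {E : Type*} [NormedAddCommGroup E] [NormedSpace ℝ E] [FiniteDimensional ℝ E]
  {G : Type*} [TopologicalSpace G] [ChartedSpace E G] [Group G]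
  {H : HomogeneousStructure E G} (N : H.QuasiNorm)

theorem setLIntegral_ball_le_morreyNorm [MeasurableSpace G] (μ : Measure G) {F : Type*} [ENorm F]
    {p : ℝ} (hp : 0 < p) {φ : ℝ → ℝ} (f : G → F) {r : ℝ} (hr : 0 < r) (hφ : 0 < φ r) :
    ∫⁻ x in N.ball 1 r, ‖f x‖ₑ ^ p ∂μ ≤
      ENNReal.ofReal (r ^ H.homDim) * (ENNReal.ofReal (φ r) * N.morreyNorm μ p φ f) ^ p := by
  have h : (ENNReal.ofReal (φ r))⁻¹ * ((ENNReal.ofReal (r ^ H.homDim))⁻¹ *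
      ∫⁻ x in N.ball 1 r, ‖f x‖ₑ ^ p ∂μ) ^ (1 / p) ≤ N.morreyNorm μ p φ f :=
    le_iSup₂_of_le r hr le_rfl
  have hφ0 : ENNReal.ofReal (φ r) ≠ 0 := by simpa using hφ
  have hQ0 : ENNReal.ofReal (r ^ H.homDim) ≠ 0 := by simpa using Real.rpow_pos_of_pos hr _
  rwa [ENNReal.inv_mul_le_iff hφ0 ENNReal.ofReal_ne_top, one_div, ENNReal.rpow_inv_le_iff hp,
    ENNReal.inv_mul_le_iff hQ0 ENNReal.ofReal_ne_top] at h

theorem morreyNorm_le_of_setLIntegral_ball_le [MeasurableSpace G] (μ : Measure G) {F : Type*}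
    [ENorm F] {p : ℝ} (hp : 0 < p) {φ : ℝ → ℝ} (hφ : ∀ t, 0 < t → 0 < φ t) (f : G → F) (X : ℝ≥0∞)
    (h : ∀ r, 0 < r → ∫⁻ x in N.ball 1 r, ‖f x‖ₑ ^ p ∂μ ≤
      ENNReal.ofReal (r ^ H.homDim) * (ENNReal.ofReal (φ r) * X) ^ p) :
    N.morreyNorm μ p φ f ≤ X := by
  refine iSup₂_le fun r hr ↦ ?_
  have hφ0 : ENNReal.ofReal (φ r) ≠ 0 := by simpa using hφ r hr
  have hQ0 : ENNReal.ofReal (r ^ H.homDim) ≠ 0 := by simpa using Real.rpow_pos_of_pos hr _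
  rw [ENNReal.inv_mul_le_iff hφ0 ENNReal.ofReal_ne_top, one_div, ENNReal.rpow_inv_le_iff hp,
    ENNReal.inv_mul_le_iff hQ0 ENNReal.ofReal_ne_top]
  exact h r hr

theorem exists_subset_ball_of_isCompact {S : Set G} (hS : IsCompact S) :
    ∃ R > 0, S ⊆ N.ball 1 R := by
  obtain ⟨M, hM⟩ := hS.bddAbove_image N.continuous_toFun.continuousOn
  refine ⟨|M| + 1, by positivity, fun x hx ↦ ?_⟩
  rw [mem_ball_one]
  linarith [hM ⟨x, hx, rfl⟩, le_abs_self M]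

/-- A quasi-ball that meets `B(1, r)` either lies in a fixed enlargement of `B(1, r)`, or is
contained in a ball about `1` of comparable radius, which is at least `r`. -/
theorem ball_subset_or {K : ℝ} (hK1 : 1 ≤ K)
    (hK : ∀ x y, N.toFun (x * y) ≤ K * max (N.toFun x) (N.toFun y)) {x z : G} {r t : ℝ}
    (hxr : x ∈ N.ball 1 r) (hxt : x ∈ N.ball z t) :
    N.ball z t ⊆ N.ball 1 (2 * K ^ 2 * r) ∨
      r ≤ 2 * K ^ 2 * t ∧ N.ball z t ⊆ N.ball 1 (2 * K ^ 2 * t) := by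
  rcases le_total t r with htr | hrt
  · have hr : 0 < r := (N.nonneg _).trans_lt (N.mem_ball_one.1 hxr)
    exact Or.inl (N.ball_subset_ball hK1 hK (by linarith) ⟨x, hxt, hxr⟩)
  · have ht : 0 < t := (N.nonneg _).trans_lt hxt
    have hK2 : 1 ≤ K ^ 2 := one_le_pow₀ hK1
    refine Or.inr ⟨by nlinarith, N.ball_subset_ball hK1 hK (by linarith)
      ⟨x, hxt, N.ball_mono 1 hrt hxr⟩⟩

variable [LieGroup 𝓘(ℝ, E) ∞ G] [T2Space G] [SecondCountableTopology G] [PathConnectedSpace G]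
  [MeasurableSpace G] [BorelSpace G] (μ : Measure G) [μ.IsHaarMeasure]

/-- Multiplicativity of ball measures reduces this to the single ratio `r / s ≤ 1`. -/
theorem rpow_mul_measure_ball_le {r s : ℝ} (hr : 0 < r) (hrs : r ≤ s) :
    ENNReal.ofReal (s ^ H.homDim) * μ (N.ball 1 r) ≤
      ENNReal.ofReal (r ^ H.homDim) * μ (N.ball 1 s) := by
  have : IsTopologicalGroup G := topologicalGroup_of_lieGroup 𝓘(ℝ, E) ∞
  have : LocallyCompactSpace G := ChartedSpace.locallyCompactSpace E G
  have hs : 0 < s := hr.trans_le hrs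
  have h1 := N.measure_ball_mul μ (div_pos hr hs) s
  rw [div_mul_cancel₀ _ hs.ne'] at h1
  have h2 := N.measure_ball_le_rpow_mul μ (div_pos hr hs) ((div_le_one hs).2 hrs)
  have h0 := (N.measure_ball_pos μ 1 one_pos).ne'
  have ht := (N.measure_ball_lt_top μ 1 1).ne
  rw [← ENNReal.mul_le_mul_iff_left h0 ht]
  calc _ = ENNReal.ofReal (s ^ H.homDim) * (μ (N.ball 1 (r / s)) * μ (N.ball 1 s)) := by
        rw [mul_assoc, h1]
    _ ≤ ENNReal.ofReal (s ^ H.homDim) *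
          (ENNReal.ofReal ((r / s) ^ H.homDim) * μ (N.ball 1 1) * μ (N.ball 1 s)) := by gcongr
    _ = ENNReal.ofReal (s ^ H.homDim * (r / s) ^ H.homDim) * μ (N.ball 1 s) * μ (N.ball 1 1) := by
        rw [ENNReal.ofReal_mul (by positivity)]; ring
    _ = _ := by
        rw [← Real.mul_rpow hs.le (by positivity), mul_div_cancel₀ _ hs.ne']

/-- Averages over balls that stay away from `1` relative to their radius. -/
theorem average_rpow_le {p : ℝ} (hp : 1 < p) {φ : ℝ → ℝ} (hφ : ∀ t, 0 < t → 0 < φ t)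
    (hanti : AntitoneOn φ (Ioi 0)) {F : Type*} [ENorm F] {f : G → F} {L : ℝ} (hL : 0 < L)
    {A : ℝ≥0} (hA : ∀ x r, μ (N.ball x (L * r)) = A * μ (N.ball x r)) {z : G} {r t : ℝ}
    (hf : AEMeasurable (fun x ↦ ‖f x‖ₑ) (μ.restrict (N.ball 1 (L * t))))
    (hr : 0 < r) (ht : 0 < t) (hrt : r ≤ L * t) (hsub : N.ball z t ⊆ N.ball 1 (L * t)) :
    ((μ (N.ball z t))⁻¹ * ∫⁻ y in N.ball z t, ‖f y‖ₑ ∂μ) ^ p ≤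
      A ^ p * ((μ (N.ball 1 r))⁻¹ * (ENNReal.ofReal (r ^ H.homDim) *
        (ENNReal.ofReal (φ r) * N.morreyNorm μ p φ f) ^ p)) := by
  have : IsTopologicalGroup G := topologicalGroup_of_lieGroup 𝓘(ℝ, E) ∞
  have : LocallyCompactSpace G := ChartedSpace.locallyCompactSpace E G
  have hp0 : 0 < p := by linarith
  set s := L * t with hs
  have hs0 : 0 < s := mul_pos hL ht
  set m := μ (N.ball 1 s) with hm
  have hm0 : m ≠ 0 := (N.measure_ball_pos μ 1 hs0).ne'
  have hmt : m ≠ ⊤ := (N.measure_ball_lt_top μ 1 s).ne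
  have hr0 : μ (N.ball 1 r) ≠ 0 := (N.measure_ball_pos μ 1 hr).ne'
  have hrt' : μ (N.ball 1 r) ≠ ⊤ := (N.measure_ball_lt_top μ 1 r).ne
  have hz0 : μ (N.ball z t) ≠ 0 := (N.measure_ball_pos μ z ht).ne'
  have hzt : μ (N.ball z t) ≠ ⊤ := (N.measure_ball_lt_top μ z t).ne
  have hinv : (μ (N.ball z t))⁻¹ = A * m⁻¹ := by
    have h1 : m = A * μ (N.ball z t) := by rw [hm, hs, hA, N.measure_ball μ z]
    have hA0 : (A : ℝ≥0∞) ≠ 0 := fun h ↦ hm0 (by rw [h1, h, zero_mul])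
    rw [h1, ENNReal.mul_inv (Or.inl hA0) (Or.inl ENNReal.coe_ne_top), ← mul_assoc,
      ENNReal.mul_inv_cancel hA0 ENNReal.coe_ne_top, one_mul]
  have hφs : ENNReal.ofReal (φ s) ≤ ENNReal.ofReal (φ r) :=
    ENNReal.ofReal_le_ofReal (hanti hr hs0 hrt)
  have hratio : m⁻¹ * ENNReal.ofReal (s ^ H.homDim) ≤
      (μ (N.ball 1 r))⁻¹ * ENNReal.ofReal (r ^ H.homDim) := by
    rw [ENNReal.inv_mul_le_iff hm0 hmt, mul_left_comm, ← ENNReal.div_eq_inv_mul,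
      ENNReal.le_div_iff_mul_le (Or.inl hr0) (Or.inl hrt')]
    exact (N.rpow_mul_measure_ball_le μ hr hrt).trans_eq (mul_comm _ _)
  -- The average contributes `m⁻¹ ^ p` and Hölder costs `m ^ (p - 1)`.
  have hmp : m⁻¹ ^ p * m ^ (p - 1) = m⁻¹ := by
    rw [ENNReal.inv_rpow, ← ENNReal.rpow_neg, ← ENNReal.rpow_add _ _ hm0 hmt,
      show -p + (p - 1) = -1 by ring, ENNReal.rpow_neg_one]
  calc ((μ (N.ball z t))⁻¹ * ∫⁻ y in N.ball z t, ‖f y‖ₑ ∂μ) ^ p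
      ≤ (A * m⁻¹ * ∫⁻ y in N.ball 1 s, ‖f y‖ₑ ∂μ) ^ p := by
        rw [hinv]
        exact ENNReal.rpow_le_rpow (mul_le_mul_right (lintegral_mono_set hsub) _) hp0.le
    _ = A ^ p * m⁻¹ ^ p * (∫⁻ y in N.ball 1 s, ‖f y‖ₑ ∂μ) ^ p := by
        rw [ENNReal.mul_rpow_of_nonneg _ _ hp0.le, ENNReal.mul_rpow_of_nonneg _ _ hp0.le]
    _ ≤ A ^ p * m⁻¹ ^ p * (m ^ (p - 1) * ∫⁻ y in N.ball 1 s, ‖f y‖ₑ ^ p ∂μ) := by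
        have h := lintegral_rpow_le_measure_univ_rpow_mul _ hf hp.le
        rw [Measure.restrict_apply_univ] at h
        exact mul_le_mul_right h _
    _ ≤ A ^ p * m⁻¹ ^ p * (m ^ (p - 1) * (ENNReal.ofReal (s ^ H.homDim) *
          (ENNReal.ofReal (φ s) * N.morreyNorm μ p φ f) ^ p)) := by
        gcongr
        exact N.setLIntegral_ball_le_morreyNorm μ hp0 f hs0 (hφ s hs0)
    _ = A ^ p * ((m⁻¹ ^ p * m ^ (p - 1)) * ENNReal.ofReal (s ^ H.homDim) *
          (ENNReal.ofReal (φ s) * N.morreyNorm μ p φ f) ^ p) := by ring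
    _ ≤ A ^ p * ((μ (N.ball 1 r))⁻¹ * ENNReal.ofReal (r ^ H.homDim) *
          (ENNReal.ofReal (φ r) * N.morreyNorm μ p φ f) ^ p) := by
        rw [hmp]; gcongr
    _ = _ := by ring

/-- Pointwise on `B(1, r)`, `M f ^ p` is at most `M g ^ p` for the truncation `g` of `|f|` to `B(1,
L r)`, plus a constant covering the far balls. -/
theorem exists_setLIntegral_maximal_rpow_le {p : ℝ} (hp : 1 < p) :
    ∃ D : ℝ≥0, ∀ φ : ℝ → ℝ, (∀ t, 0 < t → 0 < φ t) → AntitoneOn φ (Ioi 0) →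
      ∀ f : G → ℂ, (∀ S : Set G, IsCompact S → AEStronglyMeasurable f (μ.restrict S)) →
        ∀ r, 0 < r → ∫⁻ x in N.ball 1 r, N.maximal μ f x ^ p ∂μ ≤
          D * (ENNReal.ofReal (r ^ H.homDim) *
            (ENNReal.ofReal (φ r) * N.morreyNorm μ p φ f) ^ p) := by
  have : IsTopologicalGroup G := topologicalGroup_of_lieGroup 𝓘(ℝ, E) ∞
  have : LocallyCompactSpace G := ChartedSpace.locallyCompactSpace E G
  have hp0 : 0 < p := by linarith
  obtain ⟨K, hK1, hK⟩ := N.exists_toFun_mul_le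
  set L := 2 * K ^ 2 with hLdef
  have hL1 : 1 ≤ L := by nlinarith
  have hL : 0 < L := by linarith
  obtain ⟨A, hA⟩ := N.exists_measure_ball_mul_eq μ hL
  obtain ⟨A', hA'⟩ := N.exists_lintegral_maximal_rpow_le μ hp
  refine ⟨A' * (L ^ H.homDim).toNNReal + A ^ p, fun φ hφ hanti f hf r hr ↦ ?_⟩
  have hfm : ∀ R, AEMeasurable (fun x ↦ ‖f x‖ₑ) (μ.restrict (N.ball 1 R)) := fun R ↦ by
    obtain ⟨S, hS, hsub⟩ := N.exists_isCompact_ball_one_subset R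
    exact ((hf S hS).mono_set hsub).enorm
  set Y : ℝ≥0∞ := ENNReal.ofReal (r ^ H.homDim) *
    (ENNReal.ofReal (φ r) * N.morreyNorm μ p φ f) ^ p with hY
  set g : G → ℝ≥0∞ := (N.ball 1 (L * r)).indicator fun x ↦ ‖f x‖ₑ with hg
  have hgm : AEMeasurable g μ := (aemeasurable_indicator_iff (N.measurableSet_ball 1 _)).2 (hfm _)
  have hr0 : μ (N.ball 1 r) ≠ 0 := (N.measure_ball_pos μ 1 hr).ne'
  have hrt : μ (N.ball 1 r) ≠ ⊤ := (N.measure_ball_lt_top μ 1 r).ne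
  have hpt : ∀ x ∈ N.ball 1 r, N.maximal μ f x ^ p ≤
      N.maximal μ g x ^ p + A ^ p * ((μ (N.ball 1 r))⁻¹ * Y) := by
    intro x hx
    -- Taking the root exposes the supremum, so that each ball can be treated separately.
    rw [← ENNReal.le_rpow_inv_iff hp0]
    refine iSup_le fun z ↦ iSup_le fun t ↦ iSup_le fun ht ↦ iSup_le fun hxz ↦ ?_
    rw [ENNReal.le_rpow_inv_iff hp0]
    rcases N.ball_subset_or hK1 hK hx hxz with hsub | ⟨hrt, hsub⟩
    · refine le_add_right (ENNReal.rpow_le_rpow ?_ hp0.le)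
      refine le_trans (le_of_eq ?_) (N.le_maximal μ ht hxz)
      congr 1
      refine setLIntegral_congr_fun (N.measurableSet_ball z t) fun y hy ↦ ?_
      rw [enorm_eq_self, hg]
      exact (indicator_of_mem (hsub hy) fun x ↦ ‖f x‖ₑ).symm
    · exact le_add_left (N.average_rpow_le μ hp hφ hanti hL hA (hfm _) hr ht hrt hsub)
  have hgp : ∫⁻ x, g x ^ p ∂μ ≤ ENNReal.ofReal (L ^ H.homDim) * Y := by
    have h1 : ∀ x, g x ^ p = (N.ball 1 (L * r)).indicator (fun x ↦ ‖f x‖ₑ ^ p) x := fun x ↦ by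
      by_cases hx : x ∈ N.ball 1 (L * r)
      · simp [hg, hx]
      · simp [hg, hx, hp0]
    rw [lintegral_congr h1, lintegral_indicator (N.measurableSet_ball 1 _)]
    have hLr : 0 < L * r := mul_pos hL hr
    refine (N.setLIntegral_ball_le_morreyNorm μ hp0 f hLr (hφ _ hLr)).trans ?_
    rw [Real.mul_rpow hL.le hr.le, ENNReal.ofReal_mul (by positivity), mul_assoc, hY]
    have : ENNReal.ofReal (φ (L * r)) ≤ ENNReal.ofReal (φ r) :=
      ENNReal.ofReal_le_ofReal (hanti hr hLr (le_mul_of_one_le_left hr.le hL1))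
    gcongr
  calc ∫⁻ x in N.ball 1 r, N.maximal μ f x ^ p ∂μ
      ≤ ∫⁻ x in N.ball 1 r, N.maximal μ g x ^ p + A ^ p * ((μ (N.ball 1 r))⁻¹ * Y) ∂μ :=
        setLIntegral_mono' (N.measurableSet_ball 1 r) hpt
    _ = ∫⁻ x in N.ball 1 r, N.maximal μ g x ^ p ∂μ + A ^ p * Y := by
        rw [lintegral_add_right _ measurable_const, setLIntegral_const, mul_assoc, mul_right_comm,
          ENNReal.inv_mul_cancel hr0 hrt, one_mul]
    _ ≤ A' * (ENNReal.ofReal (L ^ H.homDim) * Y) + A ^ p * Y :=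
        add_le_add_left (((setLIntegral_le_lintegral _ _).trans (hA' g hgm)).trans
          (mul_le_mul_right hgp _)) _
    _ = _ := by
        push_cast
        rw [ENNReal.coe_rpow_of_nonneg _ hp0.le, ENNReal.ofReal]
        ring

end HomogeneousStructure.QuasiNorm

end

theorem theorem3p2
    {E : Type*} [NormedAddCommGroup E] [NormedSpace ℝ E] [FiniteDimensional ℝ E]
    {G : Type*} [TopologicalSpace G] [T2Space G] [SecondCountableTopology G]
    [SimplyConnectedSpace G] [ChartedSpace E G] [Group G] [LieGroup 𝓘(ℝ, E) ∞ G]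
    [MeasurableSpace G] [BorelSpace G] (μ : Measure G) [μ.IsHaarMeasure]
    (H : HomogeneousStructure E G) (N : H.QuasiNorm) (p : ℝ) (hp : 1 < p) :
    ∃ C : ℝ≥0, 0 < C ∧ ∀ φ : ℝ → ℝ,
      (∀ t, 0 < t → 0 < φ t) → AntitoneOn φ (Ioi 0) →
      MonotoneOn (fun t ↦ t ^ (H.homDim / p) * φ t) (Ioi 0) →
      ∀ f : G → ℂ, N.MemMorrey μ p φ f →
        N.MemMorrey μ p φ (N.maximal μ f) ∧
          N.morreyNorm μ p φ (N.maximal μ f) ≤ C * N.morreyNorm μ p φ f := by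
  have : IsTopologicalGroup G := topologicalGroup_of_lieGroup 𝓘(ℝ, E) ∞
  have hp0 : 0 < p := by linarith
  obtain ⟨D, hD⟩ := N.exists_setLIntegral_maximal_rpow_le μ hp
  -- `D` may be zero; `D + 1` makes the constant positive.
  refine ⟨(D + 1) ^ p⁻¹, by positivity, fun φ hφ hanti _ f hf ↦ ?_⟩
  have hbound := hD φ hφ hanti f fun S hS ↦ (hf.1 S hS).aestronglyMeasurable
  have hnorm : N.morreyNorm μ p φ (N.maximal μ f) ≤
      ((D + 1) ^ p⁻¹ : ℝ≥0) * N.morreyNorm μ p φ f := by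
    refine N.morreyNorm_le_of_setLIntegral_ball_le μ hp0 hφ _ _ fun r hr ↦ ?_
    simp only [enorm_eq_self]
    refine (hbound r hr).trans ?_
    rw [mul_left_comm (ENNReal.ofReal (φ r)), ENNReal.mul_rpow_of_nonneg (_ : ℝ≥0) _ hp0.le,
      ← ENNReal.coe_rpow_of_nonneg _ hp0.le, NNReal.rpow_inv_rpow hp0.ne', mul_left_comm]
    exact mul_le_mul_right (mul_le_mul_left (ENNReal.coe_le_coe.2 le_self_add) _) _
  have hlt : N.morreyNorm μ p φ (N.maximal μ f) < ⊤ :=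
    hnorm.trans_lt (ENNReal.mul_lt_top ENNReal.coe_lt_top hf.2)
  refine ⟨⟨fun S hS ↦ ⟨(N.measurable_maximal μ f).aestronglyMeasurable, ?_⟩, hlt⟩, hnorm⟩
  obtain ⟨R, hR, hsub⟩ := N.exists_subset_ball_of_isCompact hS
  rw [eLpNorm_lt_top_iff_lintegral_rpow_enorm_lt_top (by simpa using hp0) ENNReal.ofReal_ne_top,
    ENNReal.toReal_ofReal hp0.le]
  refine (lintegral_mono_set hsub).trans_lt
    ((N.setLIntegral_ball_le_morreyNorm μ hp0 _ hR (hφ R hR)).trans_lt ?_)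
  exact ENNReal.mul_lt_top ENNReal.ofReal_lt_top (ENNReal.rpow_lt_top_of_nonneg hp0.le
    (ENNReal.mul_ne_top ENNReal.ofReal_ne_top hlt.ne))
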